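/- Let $K$ be a commutative integral domain, let $V$ be a free $K$-module of finite rank $n\ge 0$, let $r\ge 0$, and let $\mathfrak{S}_r$ be the symmetric group on $\{1,\dots,r\}$, with permutations written on the right of their argument, so that $a(\sigma\tau)=(a\sigma)\tau$. Let $A=K\mathfrak{S}_r$ act on $V^{\otimes r}$ from the right by place permutations, $$(u_1\otimes\cdots\otimes u_r)\,\sigma=u_{1\sigma^{-1}}\otimes\cdots\otimes u_{r\sigma^{-1}},$$ and let $\Phi:K\mathfrak{S}_r\to\operatorname{End}_K(V^{\otimes r})$ be the corresponding representation (so $\Phi(ab)$ is $\Phi(a)$ followed by $\Phi(b)$). For a partition $\lambda=(\lambda_1\ge\lambda_2\ge\cdots)$ of $r$, a $\lambda$-tableau is a bijection from the boxes of the Young diagram of $\lambda$ to $\{1,\dots,r\}$; it is standard if its entries increase along rows from left to right and down columns from top to bottom. $\mathfrak{S}_r$ acts on $\lambda$-tableaux from the right by permuting entries. Let $T^\lambda$ be the $\lambda$-tableau in which $1,\dots,r$ are inserted in order from left to right along the rows, read from top to bottom. Let $\mathfrak{S}_\lambda\subseteq\mathfrak{S}_r$ be the subgroup of permutations which permute the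 entries in each row of $T^\lambda$ amongst themselves, and set $y_\lambda=\sum_{w\in\mathfrak{S}_\lambda}(\operatorname{sgn}w)\,w$. For a $\lambda$-tableau $T$ let $d(T)\in\mathfrak{S}_r$ be the unique permutation with $T=T^\lambda d(T)$, and for $\lambda$-tableaux $S,T$ set $$y_{ST}=d(S)^{-1}\,y_\lambda\,d(T)\in A.$$ Let $P$ be the set of partitions $\lambda$ of $r$ with $\lambda_1>n$, and let $A[P]=\sum K\,y_{ST}$ be the $K$-span of the elements $y_{ST}$, over all pairs $(S,T)$ of standard $\lambda$-tableaux with $\lambda\in P$. Then $A[P]$ is a two-sided ideal of $A$, and $$\ker\Phi=\operatorname{ann}_{K\mathfrak{S}_r}V^{\otimes r}=\{a\in A : xa=0\text{ for all }x\in V^{\otimes r}\}=A[P].$$ -/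

import Mathlib

open scoped TensorProduct

noncomputable section

namespace SchurWeyl

/-! ### The symmetric group, acting from the right -/

/-- The symmetric group on `r` letters, permutations being written on the right of their
argument, so that `a (σ τ) = (a σ) τ`. It is the opposite of the group `Equiv.Perm (Fin r)`,
in which permutations are composed as maps written on the left. The letters `1, …, r` are
`0, …, r - 1 : Fin r`. -/
abbrev SymGrp (r : ℕ) : Type := (Equiv.Perm (Fin r))ᵐᵒᵖ

instance {r : ℕ} : Fintype (SymGrp r) := Fintype.ofEquiv _ MulOpposite.opEquiv

/-- `image a σ` is the image `a σ` of the letter `a` under `σ`. -/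
def image {r : ℕ} (a : Fin r) (σ : SymGrp r) : Fin r := σ.unop a

theorem image_mul {r : ℕ} (a : Fin r) (σ τ : SymGrp r) :
    image a (σ * τ) = image (image a σ) τ := rfl

theorem image_one {r : ℕ} (a : Fin r) : image a (1 : SymGrp r) = a := rfl

theorem image_inv_image {r : ℕ} (a : Fin r) (σ : SymGrp r) :
    image (image a σ⁻¹) σ = a := by
  rw [← image_mul, inv_mul_cancel, image_one]

/-- The sign of a permutation as a scalar. -/
def sgn (K : Type*) [CommRing K] {r : ℕ} (σ : SymGrp r) : K :=
  ((Equiv.Perm.sign σ.unop : ℤ) : K)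

/-- The group algebra `A = K 𝔖_r`. -/
abbrev GroupAlg (K : Type*) [CommRing K] (r : ℕ) : Type _ := MonoidAlgebra K (SymGrp r)

/-! ### The place permutation action on tensor space -/

section Action

variable (K : Type*) [CommRing K] (V : Type*) [AddCommGroup V] [Module K V] (r : ℕ)

/-- The tensor power `V^{⊗ r}`. -/
abbrev TensorSpace : Type _ := ⨂[K] _ : Fin r, V

/-- Place permutation of tensors. -/
def placePerm : Equiv.Perm (Fin r) →* Module.End K (TensorSpace K V r) where
  toFun σ := (PiTensorProduct.reindex K (fun _ : Fin r => V) σ).toLinearMap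
  map_one' := by
    apply PiTensorProduct.ext
    ext u
    simp only [LinearMap.compMultilinearMap_apply, LinearEquiv.coe_coe]
    erw [PiTensorProduct.reindex_tprod]
    rfl
  map_mul' σ τ := by
    apply PiTensorProduct.ext
    ext u
    simp only [LinearMap.compMultilinearMap_apply, LinearEquiv.coe_coe, Module.End.mul_apply]
    erw [PiTensorProduct.reindex_tprod, PiTensorProduct.reindex_tprod,
      PiTensorProduct.reindex_tprod]
    rfl

/-- The representation `Φ` of `K 𝔖_r` on `V^{⊗ r}` given by the right action of `𝔖_r` by place
permutations, see `act_of_tprod`. As endomorphisms are written on the left of their argument, a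
right action is an algebra homomorphism to the opposite of the endomorphism algebra. -/
def Phi : GroupAlg K r →ₐ[K] (Module.End K (TensorSpace K V r))ᵐᵒᵖ :=
  MonoidAlgebra.lift K _ (SymGrp r) (MonoidHom.op (placePerm K V r))

variable {K V r}

/-- `act x a` is the element `x a` of the right `K 𝔖_r`-module `V^{⊗ r}`. -/
def act (x : TensorSpace K V r) (a : GroupAlg K r) : TensorSpace K V r :=
  (Phi K V r a).unop x

/-- `(u₁ ⊗ ⋯ ⊗ u_r) σ` has `u_{i σ⁻¹}` in position `i`. -/
theorem act_of_tprod (u : Fin r → V) (σ : SymGrp r) :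
    act (PiTensorProduct.tprod K u) (MonoidAlgebra.of K (SymGrp r) σ) =
      PiTensorProduct.tprod K (fun i => u (image i σ⁻¹)) := by
  unfold act Phi
  rw [MonoidAlgebra.lift_of]
  exact PiTensorProduct.reindex_tprod _ _

theorem act_mul (x : TensorSpace K V r) (a b : GroupAlg K r) :
    act x (a * b) = act (act x a) b := by
  simp [act]

end Action

/-! ### Tableaux

A partition `λ` of `r` is given by its Young diagram `μ : YoungDiagram` with `μ.card = r`. The
boxes are the pairs `(i, j) ∈ μ` (row `i`, column `j`, counted from `0`), and the part `λ_{i+1}`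
is `μ.rowLen i`. -/

/-- A tableau of shape `μ`: a bijection from the boxes to the letters. -/
abbrev Tableau (μ : YoungDiagram) (r : ℕ) : Type := μ.cells ≃ Fin r

namespace Tableau

variable {μ : YoungDiagram} {r : ℕ}

/-- The entries increase along each row. -/
def IsRowStandard (T : Tableau μ r) : Prop :=
  ∀ c d : μ.cells, c.1.1 = d.1.1 → c.1.2 < d.1.2 → T c < T d

/-- Row standard, and the entries increase down each column. -/
def IsStandard (T : Tableau μ r) : Prop :=
  T.IsRowStandard ∧ ∀ c d : μ.cells, c.1.2 = d.1.2 → c.1.1 < d.1.1 → T c < T d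

/-- The right action of the symmetric group on tableaux, by permuting the entries. -/
def permute (T : Tableau μ r) (σ : SymGrp r) : Tableau μ r := T.trans σ.unop

theorem permute_apply (T : Tableau μ r) (σ : SymGrp r) (c : μ.cells) :
    T.permute σ c = image (T c) σ := rfl

theorem permute_mul (T : Tableau μ r) (σ τ : SymGrp r) :
    T.permute (σ * τ) = (T.permute σ).permute τ := rfl

/-- The row of `T` in which a letter is found. -/
def rowOf (T : Tableau μ r) (a : Fin r) : ℕ := (T.symm a).1.1

/-- The row stabilizer `R(T)`: the permutations which permute the entries in each row of `T`
amongst themselves. -/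
def rowStabilizer (T : Tableau μ r) : Subgroup (SymGrp r) where
  carrier := {σ | ∀ a, T.rowOf (image a σ) = T.rowOf a}
  one_mem' _ := rfl
  mul_mem' {σ τ} hσ hτ a := by rw [image_mul, hτ, hσ]
  inv_mem' {σ} hσ a := by rw [← hσ (image a σ⁻¹), image_inv_image]

/-- The tableau `T^λ`, in which the letters are inserted in order from left to right along
rows, read from top to bottom, i.e. in the lexicographic order of the boxes `(i, j)`. -/
def initial (μ : YoungDiagram) {r : ℕ} (h : μ.card = r) : Tableau μ r :=
  (toLex.subtypeEquiv (fun c => by simp)).trans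
    ((μ.cells.map toLex.toEmbedding).orderIsoOfFin
      (by rw [Finset.card_map]; exact h)).symm.toEquiv

theorem initial_lt_initial_iff (h : μ.card = r) (c d : μ.cells) :
    initial μ h c < initial μ h d ↔ c.1.1 < d.1.1 ∨ c.1.1 = d.1.1 ∧ c.1.2 < d.1.2 := by
  unfold initial
  have key := ((μ.cells.map toLex.toEmbedding).orderIsoOfFin (k := r)
      (by rw [Finset.card_map]; exact h)).symm.lt_iff_lt
    (x := ⟨toLex c.1, by simp⟩) (y := ⟨toLex d.1, by simp⟩)
  exact key.trans (Prod.Lex.toLex_lt_toLex (x := c.1) (y := d.1))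

/-- The permutation `d(T)` with `T = T^λ d(T)`. -/
def d (h : μ.card = r) (T : Tableau μ r) : SymGrp r :=
  MulOpposite.op ((initial μ h).symm.trans T)

theorem initial_permute_eq_iff (h : μ.card = r) (T : Tableau μ r) (σ : SymGrp r) :
    (initial μ h).permute σ = T ↔ σ = d h T := by
  constructor
  · rintro rfl
    apply MulOpposite.unop_injective
    ext a
    simp [d, permute]
  · rintro rfl
    ext c
    simp [d, permute]

end Tableau

/-! ### Murphy's elements and the cell ideal -/

section Murphy

variable (K : Type*) [CommRing K]

open scoped Classical in
/-- `y_λ`, the sum of `(sgn w) w` over the `w` in the Young subgroup `𝔖_λ = R(T^λ)`. -/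
def yYoung {r : ℕ} (μ : YoungDiagram) (h : μ.card = r) : GroupAlg K r :=
  ∑ w : SymGrp r with w ∈ (Tableau.initial μ h).rowStabilizer,
    sgn K w • MonoidAlgebra.of K (SymGrp r) w

/-- `y_{ST} = d(S)⁻¹ y_λ d(T)`. -/
def yMurphy {r : ℕ} {μ : YoungDiagram} (h : μ.card = r) (S T : Tableau μ r) : GroupAlg K r :=
  MonoidAlgebra.of K (SymGrp r) (S.d h)⁻¹ * yYoung K μ h * MonoidAlgebra.of K (SymGrp r) (T.d h)

/-- `A[P]`, the `K`-span of the `y_{ST}` over all pairs `(S, T)` of standard tableaux of shape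
`λ`, for all partitions `λ` of `r` with `λ₁ > n`. -/
def cellIdeal (n r : ℕ) : Submodule K (GroupAlg K r) :=
  Submodule.span K {y | ∃ (μ : YoungDiagram) (h : μ.card = r), n < μ.rowLen 0 ∧
    ∃ S T : Tableau μ r, S.IsStandard ∧ T.IsStandard ∧ y = yMurphy K h S T}

end Murphy

end SchurWeyl

end

/-!
The element `y_{ST}` is, up to sign, the signed sum of all permutations that carry the rows of `S`
to the rows of `T` (`yMurphy_eq_smul_bidet`). Reading a permutation `p` as the monomial
`∏ a, x a (p a)` turns it into a multilinear product of minors of a generic matrix, a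
bideterminant, and the theorem into a statement about the span of the bideterminants that have a
factor of size greater than `n`. Bideterminants are written `bidet f g`, for arbitrary colourings
`f` and `g` of the letters whose colour classes play the role of the rows.

*Straightening* (`bidet_mem_cellIdeal`). Every bideterminant with a row of length greater than `n`
is a combination of standard ones of this kind. If a row-standard tableau is not standard, then
there is a set `X` of letters in two of its rows that is larger than either row; the sum over all
ways to redistribute `X` between the two rows equals a sum of bideterminants in which `X` is a row
of its own (`garnir_right`, `garnir_left`). The other terms of the former sum are
lexicographically smaller (`toLex_lt_of_antitoneOn`), and those of the latter have a larger shape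
(`weight_lt_weight_split`), so that the process ends. As all bideterminants with a long row are
permuted, up to sign, by left and right multiplication with permutations, their span is a
two-sided ideal; and it annihilates tensor space, because in a tensor of basis vectors two
positions in a row of length greater than `n` carry the same vector (`Phi_bidet_eq_zero`).

*The kernel is not larger* (`ker_Phi_eq_cellIdeal`). If `p` is decreasing on a set `X` of more
than `n` letters, then the bideterminant with `X` as its only row of length greater than one
expresses `p` through lexicographically smaller permutations. Hence, modulo the ideal, the group
algebra is spanned by the permutations without decreasing subsequences of length greater than `n`
(`signed_mem_span_sup_cellIdeal`). These act linearly independently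
(`eq_zero_of_mem_span_of_Phi_eq_zero`): such a `p` is increasing on the classes of a colouring `f`
with `n` colours, so that it is the lexicographically smallest among the permutations that take
the basis tensor `e_f` to `e_{f p⁻¹}`.
-/

open scoped TensorProduct

namespace SchurWeyl

/-! ### Bideterminants in the group algebra -/

section Bideterminant

variable (K : Type*) [CommRing K] {r : ℕ}

/-- The group algebra element `(sgn p) p`, for `p` given as a map written on the left. -/
noncomputable def signed (p : Equiv.Perm (Fin r)) : GroupAlg K r :=
  sgn K (MulOpposite.op p) • MonoidAlgebra.of K (SymGrp r) (MulOpposite.op p)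

/-- The bideterminant of two colourings `f`, `g` of the letters: the signed sum of the
permutations that carry the colouring `f` to the colouring `g`. If the permutation `p` is read as
the monomial `∏ a, x a (p a)`, this is, up to sign, the product over the colours `k` of the minors
of the generic matrix with rows `f ⁻¹ k` and columns `g ⁻¹ k`; it is zero unless `f` and `g`
have the same content. -/
noncomputable def bidet {ι : Type*} [DecidableEq ι] (f g : Fin r → ι) : GroupAlg K r :=
  ∑ p with g ∘ (p : Equiv.Perm (Fin r)) = f, signed K p

variable {K}

theorem sgn_op_mul (p q : Equiv.Perm (Fin r)) :
    sgn K (MulOpposite.op (p * q)) = sgn K (MulOpposite.op p) * sgn K (MulOpposite.op q) := by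
  simp [sgn]

theorem sgn_mul_self (σ : SymGrp r) : sgn K σ * sgn K σ = 1 := by
  unfold sgn
  rcases Int.units_eq_one_or (Equiv.Perm.sign σ.unop) with h | h <;> simp [h]

theorem of_eq_sgn_smul_signed (p : Equiv.Perm (Fin r)) :
    MonoidAlgebra.of K (SymGrp r) (MulOpposite.op p) =
      sgn K (MulOpposite.op p) • signed K p := by
  rw [signed, smul_smul, sgn_mul_self, one_smul]

theorem of_mul_signed (p q : Equiv.Perm (Fin r)) :
    MonoidAlgebra.of K (SymGrp r) (MulOpposite.op q) * signed K p =
      sgn K (MulOpposite.op q) • signed K (p * q) := by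
  rw [signed, signed, mul_smul_comm, ← map_mul, ← MulOpposite.op_mul, smul_smul, sgn_op_mul,
    mul_left_comm, sgn_mul_self, mul_one]

theorem signed_mul_of (p q : Equiv.Perm (Fin r)) :
    signed K p * MonoidAlgebra.of K (SymGrp r) (MulOpposite.op q) =
      sgn K (MulOpposite.op q) • signed K (q * p) := by
  rw [signed, signed, smul_mul_assoc, ← map_mul, ← MulOpposite.op_mul, smul_smul, sgn_op_mul,
    ← mul_assoc, sgn_mul_self, one_mul]

variable {ι κ : Type*} [DecidableEq ι] [DecidableEq κ]

theorem of_mul_bidet (q : Equiv.Perm (Fin r)) (f g : Fin r → ι) :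
    MonoidAlgebra.of K (SymGrp r) (MulOpposite.op q) * bidet K f g =
      sgn K (MulOpposite.op q) • bidet K (f ∘ q) g := by
  rw [bidet, bidet, Finset.mul_sum, Finset.smul_sum]
  refine Finset.sum_equiv (Equiv.mulRight q) (fun p => ?_) (fun p _ => of_mul_signed p q)
  simp only [Finset.mem_filter_univ, Equiv.coe_mulRight, Equiv.Perm.coe_mul, ← Function.comp_assoc]
  exact (q.surjective.injective_comp_right.eq_iff).symm

theorem bidet_mul_of (q : Equiv.Perm (Fin r)) (f g : Fin r → ι) :
    bidet K f g * MonoidAlgebra.of K (SymGrp r) (MulOpposite.op q) =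
      sgn K (MulOpposite.op q) • bidet K f (g ∘ q.symm) := by
  rw [bidet, bidet, Finset.sum_mul, Finset.smul_sum]
  refine Finset.sum_equiv (Equiv.mulLeft q) (fun p => ?_) (fun p _ => signed_mul_of p q)
  simp [funext_iff]

/-- Only the partition of the letters into colour classes matters, and not the names of the
colours. -/
theorem bidet_comp_injective {π : ι → κ} (hπ : Function.Injective π) (f g : Fin r → ι) :
    bidet K (π ∘ f) (π ∘ g) = bidet K f g := by
  unfold bidet
  congr 1
  ext p
  simp only [Finset.mem_filter_univ, Function.comp_assoc]
  exact hπ.comp_left.eq_iff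

theorem exists_comp_eq_of_bidet_ne_zero {f g : Fin r → ι} (h : bidet K f g ≠ 0) :
    ∃ p : Equiv.Perm (Fin r), g ∘ p = f := by
  obtain ⟨p, hp, -⟩ := Finset.exists_ne_zero_of_sum_ne_zero h
  exact ⟨p, by simpa using hp⟩

theorem sum_bidet_right (f : Fin r → ι) (G : Finset (Fin r → ι)) :
    ∑ g ∈ G, bidet K f g = ∑ p : Equiv.Perm (Fin r) with f ∘ p.symm ∈ G, signed K p := by
  simp only [bidet, Finset.sum_filter]
  rw [Finset.sum_comm]
  refine Finset.sum_congr rfl fun p _ => ?_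
  have h : ∀ g : Fin r → ι, g ∘ p = f ↔ f ∘ p.symm = g := fun g =>
    ⟨fun h => by rw [← h]; ext; simp, fun h => by rw [← h]; ext; simp⟩
  simp only [h, Finset.sum_ite_eq]

theorem sum_bidet_left (F : Finset (Fin r → ι)) (g : Fin r → ι) :
    ∑ f ∈ F, bidet K f g = ∑ p with g ∘ (p : Equiv.Perm (Fin r)) ∈ F, signed K p := by
  simp only [bidet, Finset.sum_filter]
  rw [Finset.sum_comm]
  exact Finset.sum_congr rfl fun p _ => Finset.sum_ite_eq _ _ _

end Bideterminant

/-! ### The Garnir relations -/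

section Garnir

variable {r : ℕ} {ι : Type*} [DecidableEq ι]

/-- The colourings that agree with `g` off `X` and only use the colours `i` and `j` on `X`. -/
def recolourings (g : Fin r → ι) (X : Finset (Fin r)) (i j : ι) : Finset (Fin r → ι) :=
  Fintype.piFinset fun a => if a ∈ X then {i, j} else {g a}

/-- The colouring `g` with the letters of `X` moved to a new colour `none`. -/
def split (g : Fin r → ι) (X : Finset (Fin r)) (a : Fin r) : Option ι :=
  if a ∈ X then none else some (g a)

/-- The colourings obtained from `f` by moving some letters of colour `i` or `j` to the new
colour `none`. -/
def splittings (f : Fin r → ι) (i j : ι) : Finset (Fin r → Option ι) :=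
  Fintype.piFinset fun a => if f a = i ∨ f a = j then {none, some (f a)} else {some (f a)}

theorem comp_symm_mem_recolourings_iff (f g : Fin r → ι) (X : Finset (Fin r)) (i j : ι)
    (p : Equiv.Perm (Fin r)) :
    f ∘ p.symm ∈ recolourings g X i j ↔ split g X ∘ p ∈ splittings f i j := by
  simp only [recolourings, splittings, Fintype.mem_piFinset]
  rw [← p.forall_congr_right]
  refine forall_congr' fun a => ?_
  by_cases hX : p a ∈ X <;> by_cases hf : f a = i ∨ f a = j <;>
    simp [split, hX, hf, @eq_comm _ (g _)]

variable {K : Type*} [CommRing K]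

/-- Redistributing the letters of `X` between the rows `i` and `j` in all possible ways is the
same as giving `X` a row of its own: both sides are the signed sum of the permutations that carry
`f` to `g` off `X`, and for which the letters sent to `X` have colour `i` or `j` under `f`. -/
theorem garnir_right (f g : Fin r → ι) (X : Finset (Fin r)) (i j : ι) :
    ∑ g' ∈ recolourings g X i j, bidet K f g' =
      ∑ f' ∈ splittings f i j, bidet K f' (split g X) := by
  rw [sum_bidet_right, sum_bidet_left]
  simp only [comp_symm_mem_recolourings_iff]

/-- The relation `garnir_right` with the two colourings interchanged. -/
theorem garnir_left (f g : Fin r → ι) (X : Finset (Fin r)) (i j : ι) :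
    ∑ f' ∈ recolourings f X i j, bidet K f' g =
      ∑ g' ∈ splittings g i j, bidet K (split f X) g' := by
  rw [sum_bidet_right, sum_bidet_left]
  refine Finset.sum_congr (Finset.filter_congr fun p _ => ?_) fun _ _ => rfl
  simpa using comp_symm_mem_recolourings_iff g f X i j p.symm

theorem mem_recolourings_self {i j : ι} {g : Fin r → ι} {X : Finset (Fin r)}
    (hX : ∀ a ∈ X, g a = i ∨ g a = j) : g ∈ recolourings g X i j := by
  simp only [recolourings, Fintype.mem_piFinset]
  intro a
  by_cases ha : a ∈ X <;> simp [ha, hX]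

theorem eq_of_mem_recolourings {i j : ι} {g g' : Fin r → ι} {X : Finset (Fin r)}
    (hg : g' ∈ recolourings g X i j) {a : Fin r} (ha : a ∉ X) : g' a = g a := by
  simpa [ha] using Fintype.mem_piFinset.1 hg a

/-- The number of letters of colour `k`. -/
def rowCard (g : Fin r → ι) (k : ι) : ℕ := (Finset.univ.filter fun a => g a = k).card

theorem rowCard_comp_perm (g : Fin r → ι) (p : Equiv.Perm (Fin r)) (k : ι) :
    rowCard (g ∘ p) k = rowCard g k :=
  Finset.card_equiv p (by simp)

theorem rowCard_comp_injective {κ : Type*} [DecidableEq κ] {π : ι → κ}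
    (hπ : Function.Injective π) (g : Fin r → ι) (k : ι) :
    rowCard (π ∘ g) (π k) = rowCard g k := by
  simp [rowCard, hπ.eq_iff]

theorem rowCard_split_none (g : Fin r → ι) (X : Finset (Fin r)) :
    rowCard (split g X) none = X.card := by
  simp [rowCard, split]

theorem rowCard_split_some {g : Fin r → ι} {X : Finset (Fin r)} {k : ι}
    (hk : ∀ a ∈ X, g a ≠ k) : rowCard (split g X) (some k) = rowCard g k := by
  unfold rowCard split
  congr 1
  ext a
  by_cases ha : a ∈ X
  · simp [ha, hk a ha]
  · simp [ha]

/-- A measure of a colouring that depends on the sizes of the colour classes only. It grows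
exponentially with these sizes, so that one class of size `m + 1` outweighs any two classes of
size at most `m`. -/
def weight (g : Fin r → ι) : ℕ := ∑ a, 3 ^ rowCard g (g a)

theorem weight_le (g : Fin r → ι) : weight g ≤ r * 3 ^ r := by
  have h : ∀ a ∈ Finset.univ, 3 ^ rowCard g (g a) ≤ 3 ^ r := fun a _ =>
    Nat.pow_le_pow_right (by norm_num)
      ((Finset.card_le_univ _).trans_eq (Fintype.card_fin r))
  simpa [weight] using Finset.sum_le_card_nsmul _ _ _ h

theorem weight_comp_perm (g : Fin r → ι) (p : Equiv.Perm (Fin r)) :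
    weight (g ∘ p) = weight g := by
  unfold weight
  simp only [rowCard_comp_perm, Function.comp_apply]
  exact Equiv.sum_comp p fun a => 3 ^ rowCard g (g a)

theorem weight_comp_injective {κ : Type*} [DecidableEq κ] {π : ι → κ}
    (hπ : Function.Injective π) (g : Fin r → ι) : weight (π ∘ g) = weight g := by
  simp only [weight, Function.comp_apply, rowCard_comp_injective hπ]

theorem weight_lt_weight_split {g : Fin r → ι} {X : Finset (Fin r)} {i j : ι}
    (hX : ∀ a ∈ X, g a = i ∨ g a = j) (hji : rowCard g j ≤ rowCard g i)
    (hiX : rowCard g i < X.card) : weight g < weight (split g X) := by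
  unfold weight
  set I := Finset.univ.filter fun a => g a = i ∨ g a = j with hI
  rw [← Finset.sum_add_sum_compl I, ← Finset.sum_add_sum_compl I]
  have hout : ∀ a ∈ Iᶜ, 3 ^ rowCard (split g X) (split g X a) = 3 ^ rowCard g (g a) := by
    intro a ha
    have ha' : ¬(g a = i ∨ g a = j) := by simpa [hI] using ha
    have hs : split g X a = some (g a) := if_neg fun h => ha' (hX a h)
    rw [hs, rowCard_split_some]
    intro b hb hba
    exact ha' (hba ▸ hX b hb)
  rw [Finset.sum_congr rfl hout]
  refine Nat.add_lt_add_right ?_ _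
  have hIc : I.card ≤ 2 * rowCard g i := by
    rw [hI, Finset.filter_or, two_mul]
    exact (Finset.card_union_le _ _).trans (Nat.add_le_add_left hji _)
  have h1 : ∑ a ∈ I, 3 ^ rowCard g (g a) ≤ I.card * 3 ^ rowCard g i := by
    refine (Finset.sum_le_card_nsmul _ _ (3 ^ rowCard g i) fun a ha => ?_).trans_eq (by simp)
    refine Nat.pow_le_pow_right (by norm_num) ?_
    rcases (Finset.mem_filter.1 ha).2 with h | h <;> simp [h, hji]
  have h2 : X.card * 3 ^ X.card ≤ ∑ a ∈ I, 3 ^ rowCard (split g X) (split g X a) := by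
    have hXI : X ⊆ I := fun a ha => by simpa [hI] using hX a ha
    refine le_trans (le_of_eq ?_) (Finset.sum_le_sum_of_subset hXI)
    rw [Finset.sum_congr rfl (g := fun _ => 3 ^ X.card)]
    · simp
    · intro a ha
      simp [split, ha, ← rowCard_split_none g X]
  have h3 : (rowCard g i + 1) * 3 ^ (rowCard g i + 1) ≤ X.card * 3 ^ X.card :=
    Nat.mul_le_mul hiX (Nat.pow_le_pow_right (by norm_num) hiX)
  have h4 : I.card * 3 ^ rowCard g i ≤ 2 * rowCard g i * 3 ^ rowCard g i :=
    Nat.mul_le_mul_right _ hIc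
  have h5 : 0 < 3 ^ rowCard g i := by positivity
  rw [pow_succ] at h3
  nlinarith

theorem exists_lt_rowCard_split {n : ℕ} {g : Fin r → ι} {X : Finset (Fin r)} {i j : ι}
    (hX : ∀ a ∈ X, g a = i ∨ g a = j) (hji : rowCard g j ≤ rowCard g i)
    (hiX : rowCard g i < X.card) (hn : ∃ k, n < rowCard g k) :
    ∃ k, n < rowCard (split g X) k := by
  obtain ⟨k, hk⟩ := hn
  by_cases hkij : k = i ∨ k = j
  · refine ⟨none, ?_⟩
    rw [rowCard_split_none]
    rcases hkij with rfl | rfl <;> omega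
  · refine ⟨some k, ?_⟩
    rwa [rowCard_split_some]
    rintro a ha rfl
    exact hkij (hX a ha)

/-- A colouring that is weakly decreasing on `X` is the lexicographically largest one among its
rearrangements within `X`. -/
theorem toLex_lt_of_antitoneOn {α : Type*} [LinearOrder α] {g g' : Fin r → α}
    {X : Finset (Fin r)} (hg : AntitoneOn g X) (hX : ∀ a ∉ X, g' a = g a)
    {s : Equiv.Perm (Fin r)} (hs : g ∘ s = g') (hne : g' ≠ g) : toLex g' < toLex g := by
  rcases lt_trichotomy (toLex g') (toLex g) with h | h | h
  · exact h
  · exact absurd (toLex.injective h) hne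
  obtain ⟨x, hlt, hx⟩ := h
  simp only [Pi.toLex_apply] at hlt hx
  -- The letters of colour at least `g' x` are as many for `g` as for `g'`,
  -- but for `g'` there is the additional letter `x`.
  have hcard : (Finset.univ.filter fun a => g' x ≤ g' a).card =
      (Finset.univ.filter fun a => g' x ≤ g a).card :=
    Finset.card_equiv s (by simp [← hs])
  have hss : (Finset.univ.filter fun a => g' x ≤ g a) ⊂
      Finset.univ.filter fun a => g' x ≤ g' a := by
    refine Finset.ssubset_iff_subset_ne.2 ⟨fun a ha => ?_, fun h => ?_⟩
    · simp only [Finset.mem_filter_univ] at ha ⊢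
      by_cases haX : a ∈ X
      · have hxX : x ∈ X := by
          by_contra h
          exact hx.ne (hX x h).symm
        have hax : a < x := by
          by_contra! h
          exact absurd (ha.trans (hg hxX haX h)) hx.not_ge
        rwa [← hlt a hax]
      · rwa [hX a haX]
    · have : x ∈ Finset.univ.filter fun a => g' x ≤ g a := by rw [h]; simp
      exact hx.not_ge (by simpa using this)
  exact absurd hcard (Finset.card_lt_card hss).ne'

end Garnir

/-! ### Colourings and tableaux -/

section Tableaux

variable {r : ℕ}

theorem exists_youngDiagram {c : ℕ → ℕ} (hc : Antitone c) {N : ℕ} (hN : ∀ k, N ≤ k → c k = 0) :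
    ∃ μ : YoungDiagram, ∀ i j, (i, j) ∈ μ ↔ j < c i := by
  have hmem : ∀ x : ℕ × ℕ, x ∈ (Finset.range N ×ˢ Finset.range (c 0)).filter
      (fun x => x.2 < c x.1) ↔ x.2 < c x.1 := by
    rintro ⟨i, j⟩
    simp only [Finset.mem_filter, Finset.mem_product, Finset.mem_range, and_iff_right_iff_imp]
    intro h
    refine ⟨?_, h.trans_le (hc (Nat.zero_le i))⟩
    by_contra! hi
    simp [hN i hi] at h
  refine ⟨⟨(Finset.range N ×ˢ Finset.range (c 0)).filter (fun x => x.2 < c x.1), ?_⟩,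
    fun i j => hmem (i, j)⟩
  intro x y hyx hx
  rw [Finset.mem_coe, hmem] at hx ⊢
  exact (hyx.2.trans_lt hx).trans_le (hc hyx.1)

variable {μ : YoungDiagram} {g : Fin r → ℕ}

theorem exists_rowStandard (hμ : ∀ i j, (i, j) ∈ μ ↔ j < rowCard g i) :
    ∃ T : Tableau μ r, T.IsRowStandard ∧ T.rowOf = g := by
  let e (k : ℕ) : Fin (rowCard g k) ↪o Fin r :=
    (Finset.univ.filter fun a => g a = k).orderEmbOfFin rfl
  have he : ∀ k x, g (e k x) = k := fun k x =>
    (Finset.mem_filter.1 (Finset.orderEmbOfFin_mem _ rfl x)).2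
  have hlt : ∀ c : μ.cells, c.1.2 < rowCard g c.1.1 := fun c => (hμ _ _).1 c.2
  let t (c : μ.cells) : Fin r := e c.1.1 ⟨c.1.2, hlt c⟩
  have het : ∀ (k : ℕ) (x : Fin (rowCard g k)) (c : μ.cells), c.1 = (k, x.1) → t c = e k x := by
    rintro k x ⟨⟨i, j⟩, hc⟩ h
    obtain ⟨rfl, rfl⟩ := Prod.mk.inj h
    rfl
  have ht : Function.Bijective t := by
    constructor
    · rintro ⟨⟨i, j⟩, hc⟩ ⟨⟨i', j'⟩, hd⟩ h
      obtain rfl : i = i' := by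
        rw [← he i ⟨j, hlt ⟨(i, j), hc⟩⟩, ← he i' ⟨j', hlt ⟨(i', j'), hd⟩⟩]
        exact congrArg g h
      have := Fin.mk.inj ((e i).injective h)
      simpa using this
    · intro a
      have ha : a ∈ Set.range (e (g a)) := by
        have hrange : Set.range (e (g a)) = _ := Finset.range_orderEmbOfFin _ rfl
        rw [hrange]
        simp
      obtain ⟨x, hx⟩ := ha
      exact ⟨⟨(g a, x.1), (hμ _ _).2 x.2⟩, (het _ _ _ rfl).trans hx⟩
  refine ⟨Equiv.ofBijective t ht, ?_, ?_⟩
  · rintro ⟨⟨i, j⟩, hc⟩ ⟨⟨i', j'⟩, hd⟩ h hlt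
    obtain rfl : i = i' := h
    exact (e i).strictMono hlt
  · funext a
    obtain ⟨c, rfl⟩ := ht.2 a
    rw [Tableau.rowOf, show t c = Equiv.ofBijective t ht c from rfl, Equiv.symm_apply_apply]
    exact (he _ _).symm

/-- If the entries of `T` do not increase down a column, say from the box `c` in row `i` to the
box `d` in row `j`, then the entries of row `i` from `c` on and those of row `j` up to `d` are
more than row `i` has boxes, and each of the latter is smaller than each of the former. -/
theorem exists_standard_or_garnir (hμ : ∀ i j, (i, j) ∈ μ ↔ j < rowCard g i)
    (hg : Antitone (rowCard g)) :
    (∃ T : Tableau μ r, T.IsStandard ∧ T.rowOf = g) ∨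
      ∃ (X : Finset (Fin r)) (i j : ℕ), (∀ a ∈ X, g a = i ∨ g a = j) ∧
        rowCard g j ≤ rowCard g i ∧ rowCard g i < X.card ∧ AntitoneOn g X := by
  obtain ⟨T, hT, rfl⟩ := exists_rowStandard hμ
  by_cases hcol : ∀ c d : μ.cells, c.1.2 = d.1.2 → c.1.1 < d.1.1 → T c < T d
  · exact Or.inl ⟨T, ⟨hT, hcol⟩, rfl⟩
  right
  push Not at hcol
  obtain ⟨⟨⟨i, k⟩, hc⟩, ⟨⟨j, k'⟩, hd⟩, rfl, hij, hle⟩ := hcol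
  simp only at hij
  set c : μ.cells := ⟨(i, k), hc⟩ with hc'
  set d : μ.cells := ⟨(j, k), hd⟩ with hd'
  have hlt : T d < T c := lt_of_le_of_ne hle fun h => by
    have := T.injective h
    simp only [hc', hd', Subtype.mk.injEq, Prod.mk.injEq, and_true] at this
    omega
  set A := Finset.univ.filter fun a => T.rowOf a = i ∧ T c ≤ a with hA
  set A' := Finset.univ.filter fun a => T.rowOf a = i ∧ a < T c with hA'
  set B := Finset.univ.filter fun a => T.rowOf a = j ∧ a ≤ T d with hB
  have hAA' : rowCard T.rowOf i ≤ A.card + A'.card := by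
    refine le_trans (Finset.card_le_card fun a ha => ?_) (Finset.card_union_le A A')
    have ha' : T.rowOf a = i := by simpa using ha
    rcases lt_or_ge a (T c) with h | h <;> simp [hA, hA', ha', h]
  have hA'k : A'.card ≤ k := by
    rw [← Finset.card_range k]
    refine Finset.card_le_card_of_injOn (fun a => (T.symm a).1.2) (fun a ha => ?_) ?_
    · obtain ⟨-, h1, h2⟩ := Finset.mem_filter.1 ha
      rw [Finset.mem_coe, Finset.mem_range]
      by_contra! hk
      refine h2.not_ge ?_
      rcases hk.eq_or_lt with hk | hk
      · have : c = T.symm a := Subtype.ext (Prod.ext h1.symm hk)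
        rw [this, Equiv.apply_symm_apply]
      · simpa using (hT c (T.symm a) h1.symm hk).le
    · intro a ha b hb hab
      have h1 : T.rowOf a = i := (Finset.mem_filter.1 ha).2.1
      have h2 : T.rowOf b = i := (Finset.mem_filter.1 hb).2.1
      exact T.symm.injective (Subtype.ext (Prod.ext (h1.trans h2.symm) hab))
  have hBk : k + 1 ≤ B.card := by
    have hmem : ∀ x ∈ Finset.range (k + 1), (j, x) ∈ μ.cells := fun x hx =>
      μ.up_left_mem le_rfl (Nat.lt_succ_iff.1 (Finset.mem_range.1 hx)) hd
    rw [← Finset.card_range (k + 1), ← Finset.card_attach]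
    refine Finset.card_le_card_of_injOn (fun x => T ⟨(j, x.1), hmem x.1 x.2⟩) ?_ ?_
    · rintro ⟨x, hx⟩ -
      simp only [hB, Finset.coe_filter, Finset.mem_univ, true_and, Set.mem_ofPred_eq]
      refine ⟨by simp [Tableau.rowOf], ?_⟩
      rcases (Nat.lt_succ_iff.1 (Finset.mem_range.1 hx)).eq_or_lt with h | h
      · subst h; exact le_rfl
      · exact (hT ⟨(j, x), hmem x hx⟩ d rfl h).le
    · rintro ⟨x, hx⟩ - ⟨y, hy⟩ - h
      simpa using T.injective h
  have hdisj : Disjoint A B := by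
    rw [Finset.disjoint_left]
    intro a ha hb
    have h1 := (Finset.mem_filter.1 ha).2.1
    have h2 := (Finset.mem_filter.1 hb).2.1
    omega
  refine ⟨A ∪ B, i, j, ?_, hg hij.le, ?_, ?_⟩
  · intro a ha
    rcases Finset.mem_union.1 ha with h | h
    · exact Or.inl (Finset.mem_filter.1 h).2.1
    · exact Or.inr (Finset.mem_filter.1 h).2.1
  · rw [Finset.card_union_of_disjoint hdisj]
    omega
  · intro a ha b hb hab
    simp only [hA, hB, Finset.coe_union, Finset.coe_filter, Finset.mem_univ, true_and,
      Set.mem_union, Set.mem_ofPred_eq] at ha hb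
    rcases ha with ⟨ha, ha'⟩ | ⟨ha, ha'⟩ <;> rcases hb with ⟨hb, hb'⟩ | ⟨hb, hb'⟩
    · exact (hb.trans ha.symm).le
    · exact absurd (ha'.trans (hab.trans hb')) hlt.not_ge
    · omega
    · exact (hb.trans ha.symm).le

/-- The colours can be renamed such that the sizes of the colour classes decrease. -/
theorem exists_antitone_rowCard (g : Fin r → ℕ) :
    ∃ π : Equiv.Perm ℕ, Antitone (rowCard (π ∘ g)) := by
  obtain ⟨N, hN⟩ : ∃ N, ∀ a, g a < N :=
    ⟨Finset.univ.sup g + 1, fun a => Nat.lt_succ_of_le (Finset.le_sup (Finset.mem_univ a))⟩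
  let c : Fin N → ℕᵒᵈ := fun k => OrderDual.toDual (rowCard g k)
  let τ : Equiv.Perm ℕ := (Tuple.sort c).extendDomain Fin.equivSubtype
  have hτlt : ∀ k : Fin N, τ k = Tuple.sort c k := fun k =>
    Equiv.Perm.extendDomain_apply_image (Tuple.sort c) Fin.equivSubtype k
  have hτge : ∀ k, N ≤ k → τ k = k := fun k hk =>
    Equiv.Perm.extendDomain_apply_not_subtype _ _ (by simpa using hk)
  have hzero : ∀ k, N ≤ k → rowCard g k = 0 := fun k hk => by
    rw [rowCard, Finset.card_eq_zero, Finset.filter_eq_empty_iff]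
    intro a _ h
    exact absurd (hN a) (by omega)
  have hcard : ∀ k, rowCard (τ.symm ∘ g) k = rowCard g (τ k) := fun k => by
    conv_lhs => rw [← τ.symm_apply_apply k]
    exact rowCard_comp_injective τ.symm.injective g (τ k)
  refine ⟨τ.symm, fun k l hkl => ?_⟩
  rw [hcard, hcard]
  by_cases hl : l < N
  · have hk : k < N := hkl.trans_lt hl
    have h := Tuple.monotone_sort c (show (⟨k, hk⟩ : Fin N) ≤ ⟨l, hl⟩ from hkl)
    have hk' := hτlt ⟨k, hk⟩
    have hl' := hτlt ⟨l, hl⟩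
    simp only at hk' hl'
    rw [hk', hl']
    exact h
  · rw [hτge l (by omega), hzero l (by omega)]
    exact Nat.zero_le _

end Tableaux

/-! ### Murphy's elements are bideterminants -/

section MurphyBidet

variable (K : Type*) [CommRing K] {r : ℕ} {μ : YoungDiagram}

theorem yYoung_eq_bidet (h : μ.card = r) :
    yYoung K μ h =
      bidet K (Tableau.initial μ h).rowOf (Tableau.initial μ h).rowOf := by
  classical
  unfold yYoung bidet
  refine Finset.sum_equiv MulOpposite.opEquiv.symm (fun w => ?_) (fun w _ => rfl)
  simp only [Finset.mem_filter_univ, funext_iff]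
  rfl

theorem rowOf_initial_comp_d (h : μ.card = r) (T : Tableau μ r) :
    (Tableau.initial μ h).rowOf ∘ (T.d h).unop.symm = T.rowOf := by
  funext a
  simp [Tableau.rowOf, Tableau.d]

theorem yMurphy_eq_smul_bidet (h : μ.card = r) (S T : Tableau μ r) :
    yMurphy K h S T = (sgn K (S.d h) * sgn K (T.d h)) • bidet K S.rowOf T.rowOf := by
  have hsgn : sgn K (S.d h)⁻¹ = sgn K (S.d h) := by simp [sgn]
  have h1 := of_mul_bidet (K := K) (S.d h)⁻¹.unop (Tableau.initial μ h).rowOf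
    (Tableau.initial μ h).rowOf
  have h2 := bidet_mul_of (K := K) (T.d h).unop S.rowOf (Tableau.initial μ h).rowOf
  rw [MulOpposite.op_unop, hsgn] at h1
  rw [MulOpposite.op_unop, rowOf_initial_comp_d] at h2
  have h3 : (Tableau.initial μ h).rowOf ∘ (S.d h)⁻¹.unop = S.rowOf := rowOf_initial_comp_d h S
  rw [h3] at h1
  rw [yMurphy, yYoung_eq_bidet, h1, smul_mul_assoc, h2, smul_smul]

theorem bidet_mem_cellIdeal_of_isStandard {n : ℕ} (hμ : n < μ.rowLen 0) {S T : Tableau μ r}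
    (hS : S.IsStandard) (hT : T.IsStandard) :
    bidet K S.rowOf T.rowOf ∈ cellIdeal K n r := by
  have h : μ.card = r := by
    simpa using Fintype.card_congr T
  have heq : bidet K S.rowOf T.rowOf =
      (sgn K (S.d h) * sgn K (T.d h)) • yMurphy K h S T := by
    rw [yMurphy_eq_smul_bidet, smul_smul, mul_mul_mul_comm, sgn_mul_self, sgn_mul_self, one_mul,
      one_smul]
  rw [heq]
  exact Submodule.smul_mem _ _ (Submodule.subset_span ⟨μ, h, hμ, S, T, hS, hT, rfl⟩)

end MurphyBidet

/-! ### Straightening -/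

section Straightening

variable {K : Type*} [CommRing K] {r : ℕ}

theorem mem_of_sum_mem {M κ : Type*} [AddCommGroup M] [Module K M] {C : Submodule K M}
    {G : Finset κ} {u : κ → M} (h : ∑ x ∈ G, u x ∈ C) {x : κ} (hx : x ∈ G)
    (hu : ∀ x' ∈ G, x' ≠ x → u x' ∈ C) : u x ∈ C := by
  classical
  rw [← Finset.add_sum_erase G u hx] at h
  refine (C.add_mem_iff_left (C.sum_mem fun x' hx' => ?_)).1 h
  exact hu x' (Finset.mem_of_mem_erase hx') (Finset.ne_of_mem_erase hx')

/-- The inductive step of the straightening: bideterminants of a given shape are reduced to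
standard ones and to bideterminants of larger weight. -/
theorem bidet_mem_cellIdeal_of_sorted {n w : ℕ}
    (ih : ∀ f g : Fin r → Option ℕ, w < weight g → (∃ k, n < rowCard g k) →
      bidet K f g ∈ cellIdeal K n r)
    (g : Fin r → ℕ) (hsort : Antitone (rowCard g)) (hw : weight g = w)
    (hn : ∃ k, n < rowCard g k) (f : Fin r → ℕ) : bidet K f g ∈ cellIdeal K n r := by
  obtain ⟨μ, hμ⟩ := exists_youngDiagram hsort (N := Finset.univ.sup g + 1) fun k hk => by
    rw [rowCard, Finset.card_eq_zero, Finset.filter_eq_empty_iff]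
    rintro a - rfl
    exact absurd (Finset.le_sup (f := g) (Finset.mem_univ a)) (by omega)
  have hμn : n < μ.rowLen 0 := by
    obtain ⟨k, hk⟩ := hn
    rw [← YoungDiagram.mem_iff_lt_rowLen, hμ]
    exact hk.trans_le (hsort (Nat.zero_le k))
  -- All colourings that occur have the content of `g`, and hence shape `μ`.
  obtain ⟨c, hc⟩ : ∃ c, rowCard g = c := ⟨_, rfl⟩
  rw [hc] at hμ hsort hn
  have hcomp : ∀ {g g' : Fin r → ℕ} {w : ℕ}, rowCard g = c ∧ weight g = w →
      (∃ p : Equiv.Perm (Fin r), g' ∘ p = g) → rowCard g' = c ∧ weight g' = w := by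
    rintro _ g' w ⟨h1, h2⟩ ⟨p, rfl⟩
    exact ⟨by rw [← h1]; exact funext fun k => (rowCard_comp_perm g' p k).symm,
      by rw [← h2, weight_comp_perm]⟩
  replace hc : rowCard g = c ∧ weight g = w := ⟨hc, hw⟩
  clear hw
  induction hg : toLex g using WellFoundedLT.induction generalizing g f with
  | ind _ ihg =>
  subst hg
  by_cases h0 : bidet K f g = 0
  · rw [h0]; exact zero_mem _
  obtain ⟨p, hp⟩ := exists_comp_eq_of_bidet_ne_zero h0
  rcases exists_standard_or_garnir (g := g) (by simpa [hc.1] using hμ) (by simpa [hc.1] using hsort)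
    with ⟨T, hT, rfl⟩ | ⟨X, i, j, hX, hji, hiX, hanti⟩
  · clear ihg h0
    induction hf : toLex f using WellFoundedLT.induction generalizing f p with
    | ind _ ihf =>
    subst hf
    have hcf : rowCard f = c ∧ weight f = w := hcomp hc ⟨p⁻¹, by rw [← hp]; ext; simp⟩
    rcases exists_standard_or_garnir (g := f) (by simpa [hcf.1] using hμ)
      (by simpa [hcf.1] using hsort) with ⟨S, hS, rfl⟩ | ⟨X, i, j, hX, hji, hiX, hanti⟩
    · exact bidet_mem_cellIdeal_of_isStandard K hμn hS hT
    · refine mem_of_sum_mem (u := fun f' => bidet K f' T.rowOf) (G := recolourings f X i j)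
        ?_ (mem_recolourings_self hX) fun f' hf' hne => ?_
      · rw [garnir_left]
        refine Submodule.sum_mem _ fun g' _ => ?_
        by_cases h0 : bidet K (split f X) g' = 0
        · rw [h0]; exact zero_mem _
        obtain ⟨q, hq⟩ := exists_comp_eq_of_bidet_ne_zero h0
        apply ih
        · rw [← hcf.2, ← weight_comp_perm g' q, hq]
          exact weight_lt_weight_split hX hji hiX
        · obtain ⟨k, hk⟩ := exists_lt_rowCard_split hX hji hiX (by simpa [hcf.1] using hn)
          exact ⟨k, by rwa [← rowCard_comp_perm g' q, hq]⟩
      · by_cases h0 : bidet K f' T.rowOf = 0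
        · rw [h0]; exact zero_mem _
        obtain ⟨q, hq⟩ := exists_comp_eq_of_bidet_ne_zero h0
        have hs : f ∘ (p⁻¹ * q : Equiv.Perm (Fin r)) = f' := by
          rw [← hp, ← hq]; ext; simp
        exact ihf _ (toLex_lt_of_antitoneOn hanti (fun a => eq_of_mem_recolourings hf') hs hne)
          f' q hq rfl
  · refine mem_of_sum_mem (u := fun g' => bidet K f g') (G := recolourings g X i j)
      ?_ (mem_recolourings_self hX) fun g' hg' hne => ?_
    · rw [garnir_right]
      refine Submodule.sum_mem _ fun f' _ => ?_
      apply ih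
      · rw [← hc.2]
        exact weight_lt_weight_split hX hji hiX
      · exact exists_lt_rowCard_split hX hji hiX (by simpa [hc.1] using hn)
    · by_cases h0 : bidet K f g' = 0
      · rw [h0]; exact zero_mem _
      obtain ⟨q, hq⟩ := exists_comp_eq_of_bidet_ne_zero h0
      have hs : g ∘ (p * q⁻¹ : Equiv.Perm (Fin r)) = g' := by
        rw [Equiv.Perm.coe_mul, ← Function.comp_assoc, hp, ← hq]; ext; simp
      exact ihg _ (toLex_lt_of_antitoneOn hanti (fun a => eq_of_mem_recolourings hg') hs hne)
        g' f (hcomp hc ⟨(p * q⁻¹)⁻¹, by rw [← hs]; ext; simp⟩) rfl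

/-- The span of the standard `y_{ST}` with a first row of length `> n` contains all
bideterminants with a row of length `> n`. -/
theorem bidet_mem_cellIdeal {n : ℕ} {ι : Type*} [DecidableEq ι] [Encodable ι]
    (f g : Fin r → ι) (hn : ∃ k, n < rowCard g k) : bidet K f g ∈ cellIdeal K n r := by
  -- With colours in `ℕ` there is always room for the additional colour of a Garnir relation.
  suffices h : ∀ (m : ℕ) (f g : Fin r → ℕ), r * 3 ^ r - weight g = m → (∃ k, n < rowCard g k) →
      bidet K f g ∈ cellIdeal K n r by
    rw [← bidet_comp_injective Encodable.encode_injective]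
    refine h _ _ _ rfl ?_
    obtain ⟨k, hk⟩ := hn
    exact ⟨Encodable.encode k, by rwa [rowCard_comp_injective Encodable.encode_injective]⟩
  clear hn f g
  intro m
  induction m using Nat.strong_induction_on with
  | _ m ih =>
  intro f g hm hn
  obtain ⟨π, hπ⟩ := exists_antitone_rowCard g
  rw [← bidet_comp_injective π.injective]
  refine bidet_mem_cellIdeal_of_sorted (w := weight g) (fun f' g' hlt hn' => ?_) _ hπ
    (weight_comp_injective π.injective g) ?_ _
  · have hinj : Function.Injective (Encodable.encode : Option ℕ → ℕ) := Encodable.encode_injective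
    rw [← bidet_comp_injective hinj]
    refine ih _ ?_ _ _ rfl ?_
    · rw [weight_comp_injective hinj]
      have := weight_le g'
      omega
    · obtain ⟨k, hk⟩ := hn'
      exact ⟨Encodable.encode k, by rwa [rowCard_comp_injective hinj]⟩
  · obtain ⟨k, hk⟩ := hn
    exact ⟨π k, by rwa [rowCard_comp_injective π.injective]⟩

end Straightening

/-! ### The cell ideal is a two-sided ideal -/

section Ideal

variable {K : Type*} [CommRing K] {n r : ℕ}

theorem lt_rowCard_rowOf {μ : YoungDiagram} (hμ : n < μ.rowLen 0) (T : Tableau μ r) :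
    n < rowCard T.rowOf 0 := by
  refine hμ.trans_le ?_
  have hmem : ∀ x ∈ Finset.range (μ.rowLen 0), (0, x) ∈ μ.cells := fun x hx =>
    YoungDiagram.mem_iff_lt_rowLen.2 (Finset.mem_range.1 hx)
  rw [← Finset.card_range (μ.rowLen 0), ← Finset.card_attach]
  refine Finset.card_le_card_of_injOn (fun x => T ⟨(0, x.1), hmem x.1 x.2⟩) ?_ ?_
  · rintro ⟨x, hx⟩ -
    rw [Finset.mem_coe, Finset.mem_filter_univ]
    simp [Tableau.rowOf]
  · rintro ⟨x, hx⟩ - ⟨y, hy⟩ - h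
    simpa using T.injective h

theorem cellIdeal_eq_span_bidet :
    cellIdeal K n r = Submodule.span K {y | ∃ f g : Fin r → ℕ,
      (∃ k, n < rowCard g k) ∧ y = bidet K f g} := by
  apply le_antisymm
  · rw [cellIdeal, Submodule.span_le]
    rintro _ ⟨μ, h, hμ, S, T, -, -, rfl⟩
    rw [yMurphy_eq_smul_bidet]
    exact Submodule.smul_mem _ _
      (Submodule.subset_span ⟨_, _, ⟨0, lt_rowCard_rowOf hμ T⟩, rfl⟩)
  · rw [Submodule.span_le]
    rintro _ ⟨f, g, hn, rfl⟩
    exact bidet_mem_cellIdeal f g hn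

theorem mul_mem_cellIdeal (a : GroupAlg K r) {b : GroupAlg K r} (hb : b ∈ cellIdeal K n r) :
    a * b ∈ cellIdeal K n r ∧ b * a ∈ cellIdeal K n r := by
  induction a using MonoidAlgebra.induction_on with
  | add x y hx hy =>
    rw [add_mul, mul_add]
    exact ⟨add_mem hx.1 hy.1, add_mem hx.2 hy.2⟩
  | smul c x hx =>
    rw [smul_mul_assoc, mul_smul_comm]
    exact ⟨Submodule.smul_mem _ _ hx.1, Submodule.smul_mem _ _ hx.2⟩
  | of σ =>
    obtain ⟨q⟩ := σ
    rw [cellIdeal_eq_span_bidet] at hb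
    induction hb using Submodule.span_induction with
    | zero => simp
    | add x y _ _ hx hy =>
      rw [add_mul, mul_add]
      exact ⟨add_mem hx.1 hy.1, add_mem hx.2 hy.2⟩
    | smul c x _ hx =>
      rw [smul_mul_assoc, mul_smul_comm]
      exact ⟨Submodule.smul_mem _ _ hx.1, Submodule.smul_mem _ _ hx.2⟩
    | mem x hx =>
      obtain ⟨f, g, ⟨k, hk⟩, rfl⟩ := hx
      have h1 := of_mul_bidet (K := K) q f g
      have h2 := bidet_mul_of (K := K) q f g
      refine ⟨?_, ?_⟩
      · exact h1 ▸ Submodule.smul_mem _ _ (bidet_mem_cellIdeal _ _ ⟨k, hk⟩)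
      · refine h2 ▸ Submodule.smul_mem _ _ (bidet_mem_cellIdeal _ _ ⟨k, ?_⟩)
        exact (rowCard_comp_perm g q.symm k).symm ▸ hk

end Ideal

/-! ### The cell ideal annihilates tensor space -/

section Annihilator

variable {K : Type*} [CommRing K] {V : Type*} [AddCommGroup V] [Module K V] {n r : ℕ}

theorem act_sum_smul {κ : Type*} (s : Finset κ) (c : κ → K) (u : κ → GroupAlg K r)
    (x : TensorSpace K V r) : act x (∑ i ∈ s, c i • u i) = ∑ i ∈ s, c i • act x (u i) := by
  simp [act, Finset.unop_sum]

theorem act_tprod_signed (v : Fin r → V) (p : Equiv.Perm (Fin r)) :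
    act (PiTensorProduct.tprod K v) (signed K p) =
      sgn K (MulOpposite.op p) • PiTensorProduct.tprod K (v ∘ p.symm) := by
  rw [signed, act, map_smul, MulOpposite.unop_smul, LinearMap.smul_apply]
  exact congrArg _ (act_of_tprod v (MulOpposite.op p))

theorem comp_swap_eq_self {α : Type*} {v : Fin r → α} {a b : Fin r} (h : v a = v b) :
    v ∘ Equiv.swap a b = v := by
  funext x
  rw [Function.comp_apply, Equiv.swap_apply_def]
  split_ifs with h1 h2
  · rw [h1, h]
  · rw [h2, h]
  · rfl

theorem sgn_mul_swap (p : Equiv.Perm (Fin r)) {a b : Fin r} (hab : a ≠ b) :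
    sgn K (MulOpposite.op (p * Equiv.swap a b)) = -sgn K (MulOpposite.op p) := by
  simp [sgn, Equiv.Perm.sign_swap hab]

theorem Phi_bidet_eq_zero {ι : Type*} [DecidableEq ι] (b : Module.Basis (Fin n) K V)
    (f g : Fin r → ι) (hn : ∃ k, n < rowCard g k) : Phi K V r (bidet K f g) = 0 := by
  by_cases h0 : bidet K f g = 0
  · rw [h0, map_zero]
  obtain ⟨p, hp⟩ := exists_comp_eq_of_bidet_ne_zero h0
  obtain ⟨k, hk⟩ := hn
  rw [← rowCard_comp_perm g p, hp] at hk
  apply MulOpposite.unop_injective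
  refine PiTensorProduct.ext (Module.Basis.ext_multilinear (fun _ => b) fun u => ?_)
  change act (PiTensorProduct.tprod K (b ∘ u)) (bidet K f g) = 0
  -- Two positions in a row of length `> n` carry the same basis vector.
  obtain ⟨a, ha, a', ha', hne, hu⟩ := Finset.exists_ne_map_eq_of_card_lt_of_maps_to
    (t := Finset.univ) (by simpa [rowCard] using hk) (f := u) (fun _ _ => Finset.mem_coe.2
      (Finset.mem_univ _))
  simp only [Finset.mem_filter_univ] at ha ha'
  rw [bidet, ← Finset.sum_congr rfl fun p _ => one_smul K (signed K p), act_sum_smul]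
  -- Composition with their transposition preserves the tensor and changes the sign.
  refine Finset.sum_involution (fun p _ => p * Equiv.swap a a') (fun p _ => ?_) (fun p _ _ h => ?_)
    (fun p hp => ?_) (fun p _ => by simp [mul_assoc])
  · have hv : (b ∘ u) ∘ (p * Equiv.swap a a').symm = (b ∘ u) ∘ p.symm := by
      conv_rhs => rw [← comp_swap_eq_self (v := b ∘ u) (congrArg b hu)]
      rfl
    simp only [one_smul, act_tprod_signed, hv, sgn_mul_swap p hne, neg_smul, add_neg_cancel]
  · exact hne (Equiv.swap_eq_one_iff.1 (mul_eq_left.1 h))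
  · rw [Finset.mem_filter_univ] at hp ⊢
    rw [Equiv.Perm.coe_mul, ← Function.comp_assoc, hp, comp_swap_eq_self (ha.trans ha'.symm)]

theorem cellIdeal_le_ker (b : Module.Basis (Fin n) K V) :
    cellIdeal K n r ≤ LinearMap.ker (Phi K V r).toLinearMap := by
  rw [cellIdeal_eq_span_bidet, Submodule.span_le]
  rintro _ ⟨f, g, hn, rfl⟩
  exact Phi_bidet_eq_zero b f g hn

end Annihilator

/-! ### Permutations without long decreasing subsequences -/

section NoDecreasing

variable {K : Type*} [CommRing K] {V : Type*} [AddCommGroup V] [Module K V] {n r : ℕ}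

/-- The permutation `p`, read as the word `p 0, p 1, …`, has no decreasing subsequence of length
more than `n`. -/
def NoLongDecreasing (n : ℕ) (p : Equiv.Perm (Fin r)) : Prop :=
  ∀ X : Finset (Fin r), StrictAntiOn p X → X.card ≤ n

/-- Modulo the cell ideal, every permutation is a combination of the permutations without
decreasing subsequences of length `> n`: if there is such a subsequence, then up to signs the
permutation is minus the sum of those in which the terms of the subsequence are rearranged, and
these are lexicographically smaller. -/
theorem signed_mem_span_sup_cellIdeal (p : Equiv.Perm (Fin r)) :
    signed K p ∈ Submodule.span K (Set.range fun q : {q : Equiv.Perm (Fin r) //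
      NoLongDecreasing n q} => signed K q.1) ⊔ cellIdeal K n r := by
  induction hp : toLex (p : Fin r → Fin r) using WellFoundedLT.induction generalizing p with
  | ind _ ih =>
  subst hp
  by_cases hgood : NoLongDecreasing n p
  · exact Submodule.mem_sup_left (Submodule.subset_span ⟨⟨p, hgood⟩, rfl⟩)
  rw [NoLongDecreasing] at hgood
  push Not at hgood
  obtain ⟨X, hX, hn⟩ := hgood
  -- The letters of `X` form one row, and all other rows have length one.
  have hmem : bidet K (split id X) (split id X ∘ p.symm) ∈ cellIdeal K n r := by
    refine bidet_mem_cellIdeal _ _ ⟨none, ?_⟩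
    rwa [rowCard_comp_perm, rowCard_split_none]
  refine mem_of_sum_mem (Submodule.mem_sup_right hmem) (by simp [Function.comp_assoc])
    fun q hq hne => ?_
  rw [Finset.mem_filter_univ] at hq
  refine ih _ (toLex_lt_of_antitoneOn (s := p⁻¹ * q) hX.antitoneOn (fun a ha => ?_) ?_ ?_) q rfl
  · have h := congrFun hq a
    simp only [split, Function.comp_apply, ha, if_false] at h
    split_ifs at h
    exact (p.symm_apply_eq.1 (Option.some.inj h))
  · ext; simp
  · exact fun h => hne (Equiv.coe_fn_injective h)

/-- The letters can be given `n` colours such that `p` increases on each colour class: colour a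
letter by the length of the longest decreasing subsequence ending there. -/
theorem NoLongDecreasing.exists_colouring {p : Equiv.Perm (Fin r)} (hp : NoLongDecreasing n p) :
    ∃ f : Fin r → Fin n, ∀ a b, f a = f b → a < b → p a < p b := by
  classical
  let D (a : Fin r) : Finset (Finset (Fin r)) :=
    Finset.univ.filter fun X => StrictAntiOn p X ∧ a ∈ X ∧ ∀ x ∈ X, x ≤ a
  have hD : ∀ a, {a} ∈ D a := fun a => by simp [D]
  let h (a : Fin r) : ℕ := (D a).sup Finset.card
  have hpos : ∀ a, 1 ≤ h a := fun a => Finset.le_sup (f := Finset.card) (hD a)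
  have hle : ∀ a, h a ≤ n := fun a => Finset.sup_le fun X hX => hp X (Finset.mem_filter.1 hX).2.1
  refine ⟨fun a => ⟨h a - 1, by have := hpos a; have := hle a; omega⟩, fun a b hab hlt => ?_⟩
  by_contra! hba
  replace hba : p b < p a := lt_of_le_of_ne hba fun h => hlt.ne' (p.injective h)
  obtain ⟨X, hX, hXa⟩ := Finset.exists_mem_eq_sup (D a) ⟨_, hD a⟩ Finset.card
  obtain ⟨hanti, haX, hXle⟩ := (Finset.mem_filter.1 hX).2
  have hbX : b ∉ X := fun hb => (hXle b hb).not_gt hlt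
  have hpX : ∀ x ∈ X, p b < p x := fun x hx =>
    hba.trans_le (hanti.antitoneOn hx haX (hXle x hx))
  have hmem : insert b X ∈ D b := by
    simp only [D, Finset.mem_filter_univ, Finset.coe_insert, Finset.mem_insert, true_or, true_and]
    refine ⟨?_, ?_⟩
    · rintro x (rfl | hx) y (rfl | hy) hxy
      · exact absurd hxy (lt_irrefl _)
      · exact absurd (hxy.trans_le (hXle y hy)) hlt.not_gt
      · exact hpX x hx
      · exact hanti hx hy hxy
    · rintro x (rfl | hx)
      · exact le_rfl
      · exact (hXle x hx).trans hlt.le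
  have hb : X.card + 1 ≤ h b := by
    rw [← Finset.card_insert_of_notMem hbX]
    exact Finset.le_sup (f := Finset.card) hmem
  have hXa' : h a = X.card := hXa
  have := hpos a
  have hab' : h a - 1 = h b - 1 := Fin.mk.inj hab
  omega

/-- A permutation that increases on each class of a colouring is lexicographically the smallest
one among its rearrangements within the colour classes. -/
theorem toLex_lt_of_comp_eq {ι : Type*} {f : Fin r → ι} {p s : Equiv.Perm (Fin r)}
    (hp : ∀ a b, f a = f b → a < b → p a < p b) (hs : f ∘ s = f) (hne : p * s ≠ p) :
    toLex (p : Fin r → Fin r) < toLex (⇑(p * s) : Fin r → Fin r) := by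
  rcases lt_trichotomy (toLex (p : Fin r → Fin r)) (toLex (⇑(p * s) : Fin r → Fin r))
    with h | h | h
  · exact h
  · exact absurd (Equiv.coe_fn_injective (toLex.injective h)).symm hne
  obtain ⟨x, hlt, hx⟩ := h
  simp only [Pi.toLex_apply, Equiv.Perm.mul_apply] at hlt hx
  refine absurd hx ?_
  rcases lt_trichotomy (s x) x with h | h | h
  · exact absurd (s.injective (p.injective (hlt _ h))) h.ne
  · simp [h]
  · exact (hp x (s x) (congrFun hs x).symm h).not_gt

/-- The permutations without long decreasing subsequences act linearly independently. If `f` is a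
colouring on whose classes `p` increases, then the coefficient of `e_{f p⁻¹}` in `e_f q` is
nonzero only if `q` is a rearrangement of `p` within the classes of `f`, and hence
lexicographically at least `p`. -/
theorem eq_zero_of_mem_span_of_Phi_eq_zero (b : Module.Basis (Fin n) K V) {a : GroupAlg K r}
    (ha : a ∈ Submodule.span K (Set.range fun q : {q : Equiv.Perm (Fin r) //
      NoLongDecreasing n q} => signed K q.1)) (hPhi : Phi K V r a = 0) : a = 0 := by
  classical
  obtain ⟨c, rfl⟩ := (Submodule.mem_span_range_iff_exists_fun K).1 ha
  suffices h : ∀ p, c p = 0 by simp [h]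
  intro p
  induction hp : toLex (p.1 : Fin r → Fin r) using WellFoundedGT.induction generalizing p with
  | ind _ ih =>
  subst hp
  obtain ⟨f, hf⟩ := p.2.exists_colouring
  let B := Basis.piTensorProduct fun _ : Fin r => b
  have hB : ∀ u : Fin r → Fin n, PiTensorProduct.tprod K (b ∘ u) = B u := fun u =>
    (Basis.piTensorProduct_apply _ _).symm
  have h0 : act (PiTensorProduct.tprod K (b ∘ f)) (∑ q, c q • signed K q.1) = 0 := by
    rw [act, hPhi]
    rfl
  rw [act_sum_smul] at h0
  have hact : ∀ q : Equiv.Perm (Fin r), act (PiTensorProduct.tprod K (b ∘ f)) (signed K q) =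
      sgn K (MulOpposite.op q) • B (f ∘ q.symm) := fun q => by
    rw [act_tprod_signed, Function.comp_assoc, hB]
  simp only [hact] at h0
  have h1 := congrArg (fun x => B.repr x (f ∘ p.1.symm)) h0
  simp only [map_sum, map_smul, Module.Basis.repr_self, Finsupp.coe_finsetSum, Finset.sum_apply,
    Finsupp.smul_apply, map_zero, Finsupp.coe_zero, Pi.zero_apply] at h1
  rw [Finset.sum_eq_single p] at h1
  · rw [Finsupp.single_eq_same, smul_eq_mul, smul_eq_mul, mul_one] at h1
    rw [← mul_one (c p), ← sgn_mul_self (MulOpposite.op p.1), ← mul_assoc, h1, zero_mul]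
  · intro q _ hqp
    by_cases hfq : f ∘ q.1.symm = f ∘ p.1.symm
    · have hlt := toLex_lt_of_comp_eq (s := p.1⁻¹ * q.1) hf ?_ ?_
      · rw [mul_inv_cancel_left] at hlt
        rw [ih _ hlt q rfl, zero_smul]
      · funext x
        simpa using (congrFun hfq (q.1 x)).symm
      · rw [mul_inv_cancel_left]
        exact fun h => hqp (Subtype.ext h)
    · rw [Finsupp.single_eq_of_ne (Ne.symm hfq), smul_zero, smul_zero]
  · exact fun h => absurd (Finset.mem_univ p) h

theorem ker_Phi_eq_cellIdeal (b : Module.Basis (Fin n) K V) :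
    LinearMap.ker (Phi K V r).toLinearMap = cellIdeal K n r := by
  refine le_antisymm (fun a ha => ?_) (cellIdeal_le_ker b)
  have htop : a ∈ Submodule.span K (Set.range fun q : {q : Equiv.Perm (Fin r) //
      NoLongDecreasing n q} => signed K q.1) ⊔ cellIdeal K n r := by
    clear ha
    induction a using MonoidAlgebra.induction_on with
    | of σ =>
      rw [← MulOpposite.op_unop σ, of_eq_sgn_smul_signed]
      exact Submodule.smul_mem _ _ (signed_mem_span_sup_cellIdeal _)
    | add x y hx hy => exact add_mem hx hy
    | smul c x hx => exact Submodule.smul_mem _ _ hx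
  obtain ⟨x, hx, y, hy, rfl⟩ := Submodule.mem_sup.1 htop
  have hxker : x ∈ LinearMap.ker (Phi K V r).toLinearMap :=
    ((LinearMap.ker _).add_mem_iff_left (cellIdeal_le_ker b hy)).1 ha
  rw [eq_zero_of_mem_span_of_Phi_eq_zero b hx hxker, zero_add]
  exact hy

end NoDecreasing

end SchurWeyl

theorem mainTheorem2 (K : Type*) [CommRing K] [IsDomain K]
    (V : Type*) [AddCommGroup V] [Module K V] [Module.Free K V] [Module.Finite K V]
    (n r : ℕ) (hn : Module.finrank K V = n) :
    (∀ a : SchurWeyl.GroupAlg K r, ∀ b ∈ SchurWeyl.cellIdeal K n r,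
      a * b ∈ SchurWeyl.cellIdeal K n r ∧ b * a ∈ SchurWeyl.cellIdeal K n r) ∧
    LinearMap.ker (SchurWeyl.Phi K V r).toLinearMap = SchurWeyl.cellIdeal K n r ∧
    {a : SchurWeyl.GroupAlg K r | ∀ x : SchurWeyl.TensorSpace K V r, SchurWeyl.act x a = 0} =
      SchurWeyl.cellIdeal K n r := by
  have hker := SchurWeyl.ker_Phi_eq_cellIdeal (r := r) (Module.finBasisOfFinrankEq K V hn)
  refine ⟨fun a b hb => SchurWeyl.mul_mem_cellIdeal a hb, hker, ?_⟩
  rw [← hker]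
  ext a
  rw [SetLike.mem_coe, LinearMap.mem_ker]
  exact ⟨fun h => MulOpposite.unop_injective (LinearMap.ext h),
    fun h x => LinearMap.congr_fun (congrArg MulOpposite.unop h) x⟩
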